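/- Let $k$, $l$ and $n$ be arbitrary positive integers. For a finite abelian group $G$, a subset $A\subseteq G$ and a positive integer $h$, let $hA$ denote the set of all sums of $h$ (not necessarily distinct) elements of $A$; call $A$ \emph{$(k,l)$-sum-free} if $kA\cap lA=\emptyset$. Let $\lambda_{k,l}(\mathbb{Z}_n)$ be the maximum size of a $(k,l)$-sum-free subset of the cyclic group $\mathbb{Z}_n$ of order $n$. For a positive integer $d$, let $\alpha_{k,l}(\mathbb{Z}_d)$ be the maximum size of a $(k,l)$-sum-free arithmetic progression in $\mathbb{Z}_d$, i.e. of a $(k,l)$-sum-free set of the form $\{a,a+b,\dots,a+c\cdot b\}$ with $a,b\in\mathbb{Z}_d$ and an integer $c\ge 0$, where $\alpha_{k,l}(\mathbb{Z}_d)=0$ if there is no such progression. Then $$\lambda_{k,l}(\mathbb{Z}_n)=\max_{d\mid n}\left\{\alpha_{k,l}(\mathbb{Z}_d)\cdot\frac{n}{d}\right\},$$ where $d$ runs over the positive divisors of $n$. -/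

import Mathlib

namespace SumFreeCyclic

/-- The `h`-fold sumset `hA`: all sums of `h` (not necessarily distinct) elements of `A`. -/
def hfoldSumset {G : Type*} [AddCommGroup G] (h : ℕ) (A : Set G) : Set G :=
  {x | ∃ f : Fin h → G, (∀ i, f i ∈ A) ∧ ∑ i, f i = x}

/-- `A` is `(k, l)`-sum-free: `kA ∩ lA = ∅`. -/
def IsSumFree {G : Type*} [AddCommGroup G] (k l : ℕ) (A : Set G) : Prop :=
  hfoldSumset k A ∩ hfoldSumset l A = ∅

/-- `A = {a, a + d, …, a + c • d}` for some `a d : G` and some `c ≥ 0`. -/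
def IsArithProg {G : Type*} [AddCommGroup G] (A : Set G) : Prop :=
  ∃ (a d : G) (c : ℕ), A = {x | ∃ i : ℕ, i ≤ c ∧ x = a + i • d}

/-- The sizes of the `(k, l)`-sum-free subsets of `G`. -/
def sumFreeSizes (k l : ℕ) (G : Type*) [AddCommGroup G] : Set ℕ :=
  {m | ∃ A : Set G, IsSumFree k l A ∧ A.ncard = m}

/-- The sizes of the `(k, l)`-sum-free arithmetic progressions in `G`. -/
def sumFreeProgSizes (k l : ℕ) (G : Type*) [AddCommGroup G] : Set ℕ :=
  {m | ∃ A : Set G, IsArithProg A ∧ IsSumFree k l A ∧ A.ncard = m}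

/-- `lam k l G` is the maximum size of a `(k, l)`-sum-free subset of the finite group `G`. -/
noncomputable def lam (k l : ℕ) (G : Type*) [AddCommGroup G] : ℕ :=
  sSup (sumFreeSizes k l G)

/-- `alpha k l G` is the maximum size of a `(k, l)`-sum-free arithmetic progression in the
finite group `G`, and `0` if there is none. -/
noncomputable def alpha (k l : ℕ) (G : Type*) [AddCommGroup G] : ℕ :=
  sSup (sumFreeProgSizes k l G)

/-- On a finite group and for positive `k`, the supremum `lam` is an attained maximum. -/
theorem lam_isGreatest {G : Type*} [AddCommGroup G] [Finite G] {k : ℕ} (hk : 0 < k) (l : ℕ) :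
    IsGreatest (sumFreeSizes k l G) (lam k l G) := by
  have hb : BddAbove (sumFreeSizes k l G) :=
    ⟨Nat.card G, by rintro m ⟨A, -, rfl⟩; exact Set.ncard_le_card A⟩
  have hne : (sumFreeSizes k l G).Nonempty := by
    refine ⟨0, ∅, ?_, Set.ncard_empty G⟩
    refine Set.eq_empty_iff_forall_notMem.2 ?_
    rintro x ⟨⟨f, hf, -⟩, -⟩
    exact hf ⟨0, hk⟩
  exact ⟨Nat.sSup_mem hne hb, fun m hm => le_csSup hb hm⟩

/-- On a finite group with some `(k, l)`-sum-free progression, `alpha` is an attained maximum. -/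
theorem alpha_isGreatest {G : Type*} [AddCommGroup G] [Finite G] {k l : ℕ}
    (hne : (sumFreeProgSizes k l G).Nonempty) :
    IsGreatest (sumFreeProgSizes k l G) (alpha k l G) := by
  have hb : BddAbove (sumFreeProgSizes k l G) :=
    ⟨Nat.card G, by rintro m ⟨A, -, -, rfl⟩; exact Set.ncard_le_card A⟩
  exact ⟨Nat.sSup_mem hne hb, fun m hm => le_csSup hb hm⟩

/-- Without `(k, l)`-sum-free progressions, `alpha` is `0`. -/
theorem alpha_eq_zero {G : Type*} [AddCommGroup G] {k l : ℕ}
    (h : sumFreeProgSizes k l G = ∅) : alpha k l G = 0 := by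
  rw [alpha, h, csSup_empty, bot_eq_zero]

end SumFreeCyclic

open Finset
open scoped Pointwise

/-! Lower bound: the preimage of a sum-free progression under `ZMod n → ZMod d` is sum-free and `n /
d` times as large (`isSumFree_preimage_iff`, `ncard_preimage_mul_card`).

Upper bound: let `l < k`, and induct on the order of a cyclic group `G`. Take a sum-free `A` of
maximum size, `a ∈ A`, `S = A - a` and `K` the subgroup generated by `S`.

Suppose no set is critical for `S`. Then each new summand `S` enlarges an iterated sumset by at
least `|S|` until `K` is nearly full. If `k • a - l • a ∈ K`, then `kS` and `lS` have disjoint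
translates in `K`, whence `(k + l)|A| ≤ |G|`, and an interval of `|A|` elements of `ZMod |G|` is
sum-free. Otherwise the whole coset `a + K` is sum-free, and it is a progression.

Suppose some set is critical. Hamidoune's atoms show that `S` is a progression or that `|S + H| <
|S| + |H|` for some nontrivial `H < K` (`isArithProg_or_exists_subgroup`). In the second case `A +
H` is still sum-free, since otherwise a pigeonhole argument (`sub_mem_of_hfoldSumset_sub_mem`) puts
`A` in one coset of `H`. By maximality `A = A + H`, and induction applies to `G ⧸ H`. -/

namespace SumFreeCyclic

/-! ### Critical sets and atoms (the isoperimetric method) -/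

section CriticalPairs

variable {G : Type*} [AddCommGroup G] [DecidableEq G]

/-- `X` lies in the subgroup `K`, has at least two elements, `X + S` misses at least two elements
of `K`, and `X + S` has at most `|X| + |S| - 1` elements. -/
structure IsCritical (K : AddSubgroup G) (S X : Finset G) : Prop where
  subset : ∀ x ∈ X, x ∈ K
  two_le : 2 ≤ #X
  sep : #(X + S) + 2 ≤ Nat.card K
  small : #(X + S) + 1 ≤ #X + #S

/-- Submodularity of `X ↦ |X + S|`, the engine of the atom argument. -/
theorem card_inter_add_add_card_union_add_le (X Y S : Finset G) :
    #((X ∩ Y) + S) + #((X ∪ Y) + S) ≤ #(X + S) + #(Y + S) := by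
  rw [← card_inter_add_card_union (X + S) (Y + S), union_add]
  gcongr
  exact inter_add_subset

/-- `-(K \ (X + S)) + S` misses `-X`. -/
theorem exists_dual [Finite G] {K : AddSubgroup G} {S X : Finset G} (hS : ∀ x ∈ S, x ∈ K)
    (hX : ∀ x ∈ X, x ∈ K) :
    ∃ Y : Finset G, (∀ x ∈ Y, x ∈ K) ∧ #Y + #(X + S) = Nat.card K ∧
      #(Y + S) + #X ≤ Nat.card K := by
  classical
  have := Fintype.ofFinite G
  set U : Finset G := univ.filter (· ∈ K) with hU
  have hUc : Nat.card K = #U := by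
    rw [Nat.card_eq_fintype_card, hU]
    exact Fintype.card_subtype _
  have hXS : X + S ⊆ U := by
    intro z hz
    obtain ⟨x, hx, s, hs, rfl⟩ := mem_add.1 hz
    simpa [hU] using K.add_mem (hX x hx) (hS s hs)
  refine ⟨-(U \ (X + S)), ?_, ?_, ?_⟩
  · intro x hx
    have := mem_sdiff.1 (mem_neg'.1 hx)
    simpa [hU] using this.1
  · rw [card_neg, hUc, card_sdiff_add_card_eq_card hXS]
  · rw [hUc, ← card_neg X, ← card_union_of_disjoint]
    · refine card_le_card (union_subset ?_ ?_)
      · intro z hz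
        obtain ⟨y, hy, s, hs, rfl⟩ := mem_add.1 hz
        have := (mem_sdiff.1 (mem_neg'.1 hy)).1
        simp only [hU, mem_filter, mem_univ, true_and, neg_mem_iff] at this ⊢
        exact K.add_mem this (hS s hs)
      · intro z hz
        simpa [hU] using hX _ (mem_neg'.1 hz)
    · rw [Finset.disjoint_left]
      intro z hz hz'
      obtain ⟨y, hy, s, hs, rfl⟩ := mem_add.1 hz
      refine (mem_sdiff.1 (mem_neg'.1 hy)).2 (mem_add.2 ⟨_, mem_neg'.1 hz', s, hs, by abel⟩)

/-- An atom: minimise `|X + S| - |X|`, then `|X|`. If a translate `N ≠ M` met `M` in two or more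
points, then `M ∩ N` would be admissible but too small to be optimal, so by submodularity `M ∪ N`
would beat the minimum. -/
theorem exists_atom [Finite G] {K : AddSubgroup G} {S X : Finset G} (hS : ∀ x ∈ S, x ∈ K)
    (hX : IsCritical K S X) :
    ∃ M, IsCritical K S M ∧ 0 ∈ M ∧ ∀ g : G, g +ᵥ M = M ∨ #(M ∩ (g +ᵥ M)) ≤ 1 := by
  let F : Set (Finset G) := {X | (∀ x ∈ X, x ∈ K) ∧ 2 ≤ #X ∧ #(X + S) + 2 ≤ Nat.card K}
  let f : Finset G → ℤ := fun X => (#(X + S) : ℤ) - #X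
  obtain ⟨M₁, hM₁, hmin₁⟩ := Set.exists_min_image F f (Set.toFinite F)
    ⟨X, hX.subset, hX.two_le, hX.sep⟩
  obtain ⟨M₂, ⟨hM₂F, hM₂f⟩, hmin₂⟩ := Set.exists_min_image {X ∈ F | f X = f M₁} card
    (Set.toFinite _) ⟨M₁, hM₁, rfl⟩
  obtain ⟨m, hm⟩ : M₂.Nonempty := card_pos.1 (by have := hM₂F.2.1; omega)
  have htr : ∀ (g : G) (M : Finset G), #((g +ᵥ M) + S) = #(M + S) := fun g M => by
    rw [vadd_add_assoc, card_vadd_finset]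
  let M := (-m) +ᵥ M₂
  have hMc : #M = #M₂ := card_vadd_finset _ _
  have hMS : #(M + S) = #(M₂ + S) := htr _ _
  have hMF : M ∈ F := by
    refine ⟨?_, by rw [hMc]; exact hM₂F.2.1, by rw [hMS]; exact hM₂F.2.2⟩
    intro x hx
    obtain ⟨y, hy, rfl⟩ := mem_vadd_finset.1 hx
    exact K.add_mem (K.neg_mem (hM₂F.1 m hm)) (hM₂F.1 y hy)
  have hfM : f M = f M₁ := by simp only [f, hMc, hMS]; exact hM₂f
  have hsmall : #(M + S) + 1 ≤ #M + #S := by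
    have h1 := hmin₁ X ⟨hX.subset, hX.two_le, hX.sep⟩
    have h2 := hX.small
    rw [← hfM] at h1
    simp only [f] at h1
    omega
  refine ⟨M, ⟨hMF.1, hMF.2.1, hMF.2.2, hsmall⟩, ?_, ?_⟩
  · exact mem_vadd_finset.2 ⟨m, hm, by simp⟩
  intro g
  by_contra! hcon
  obtain ⟨hne, htwo⟩ := hcon
  -- The dual set is also a minimiser, hence at least as large as `M`. This bound is what keeps `(M
  -- ∪ N) + S` two elements short of `K`.
  have hMle : #M + #(M + S) ≤ Nat.card K := by
    obtain ⟨Y, hYK, hYc, hYS⟩ := exists_dual hS hMF.1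
    have hYF : Y ∈ F := ⟨hYK, by have := hMF.2.2; omega, by have := hMF.2.1; omega⟩
    have h1 := hmin₁ Y hYF
    have h2 := hmin₂ Y ⟨hYF, by
      refine le_antisymm ?_ h1
      rw [← hfM]
      simp only [f]
      omega⟩
    omega
  set N := g +ᵥ M with hN
  have hNc : #N = #M := card_vadd_finset _ _
  have hgK : g ∈ K := by
    obtain ⟨x, hx⟩ : (M ∩ N).Nonempty := card_pos.1 (by omega)
    obtain ⟨hx1, hx2⟩ := mem_inter.1 hx
    obtain ⟨y, hy, rfl⟩ := mem_vadd_finset.1 hx2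
    have := K.sub_mem (hMF.1 _ hx1) (hMF.1 y hy)
    simpa using this
  have hNK : ∀ x ∈ N, x ∈ K := by
    intro x hx
    obtain ⟨y, hy, rfl⟩ := mem_vadd_finset.1 hx
    exact K.add_mem hgK (hMF.1 y hy)
  have hlt : #(M ∩ N) < #M := by
    refine lt_of_le_of_ne (card_le_card inter_subset_left) fun h => hne ?_
    have h1 : M ∩ N = M := eq_of_subset_of_card_le inter_subset_left h.ge
    exact (eq_of_subset_of_card_le (inter_eq_left.1 h1) hNc.le).symm
  have hsub := card_inter_add_add_card_union_add_le M N S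
  have hcu := card_inter_add_card_union M N
  have hNS : #(N + S) = #(M + S) := htr _ _
  have hIF : M ∩ N ∈ F := ⟨fun x hx => hMF.1 x (mem_inter.1 hx).1, by omega, by
    have := card_le_card (add_subset_add_right (t := S) (inter_subset_left (s₁ := M) (s₂ := N)))
    have := hMF.2.2
    omega⟩
  have hI1 : f M < f (M ∩ N) := by
    refine lt_of_le_of_ne (by rw [hfM]; exact hmin₁ _ hIF) fun h => ?_
    have := hmin₂ _ ⟨hIF, by rw [← h, hfM]⟩
    omega
  have hUF : M ∪ N ∈ F := by
    refine ⟨fun x hx => (mem_union.1 hx).elim (hMF.1 x) (hNK x), ?_, ?_⟩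
    · have := card_le_card (subset_union_left (s₁ := M) (s₂ := N))
      have := hMF.2.1
      omega
    · simp only [f] at hI1
      omega
  have hU1 := hmin₁ _ hUF
  rw [← hfM] at hU1
  simp only [f] at hI1 hU1
  omega

/-- Distinct translates of `M` share at most one element. -/
def IsSidon (M : Finset G) : Prop := ∀ g : G, g ≠ 0 → #(M ∩ (g +ᵥ M)) ≤ 1

/-- If some `g ≠ 0` fails the Sidon condition, then `g` is a period of the atom `M`. For each `a ∈
M` the points `a` and `g + a` then lie in `M ∩ (a + M)`, so `a` is a period too. -/
theorem exists_subgroup_or_sidon [Finite G] {K : AddSubgroup G} {S X : Finset G}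
    (hS : ∀ x ∈ S, x ∈ K) (hX : IsCritical K S X) :
    ∃ M, IsCritical K S M ∧ 0 ∈ M ∧ ((∃ H : AddSubgroup G, (H : Set G) = M) ∨ IsSidon M) := by
  obtain ⟨M, hM, h0, h⟩ := exists_atom hS hX
  refine ⟨M, hM, h0, ?_⟩
  by_cases hs : IsSidon M
  · exact Or.inr hs
  left
  simp only [IsSidon, not_forall] at hs
  obtain ⟨g, hg, hgM⟩ := hs
  have hper : g +ᵥ M = M := (h g).resolve_right hgM
  have hmem : ∀ x, x ∈ M ↔ g + x ∈ M := fun x => by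
    conv_rhs => rw [← hper]
    exact (vadd_mem_vadd_finset_iff g (b := x)).symm
  have hall : ∀ a ∈ M, a +ᵥ M = M := by
    intro a ha
    refine (h a).resolve_right fun hle => hg ?_
    have h1 : a ∈ M ∩ (a +ᵥ M) := mem_inter.2 ⟨ha, mem_vadd_finset.2 ⟨0, h0, by simp⟩⟩
    have h2 : g + a ∈ M ∩ (a +ᵥ M) :=
      mem_inter.2 ⟨(hmem a).1 ha, mem_vadd_finset.2 ⟨g, by simpa using (hmem 0).1 h0, by
        simp [add_comm]⟩⟩
    have := card_le_one.1 hle _ h1 _ h2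
    simpa using this
  have hadd : ∀ a ∈ M, ∀ b ∈ M, a + b ∈ M := fun a ha b hb => by
    rw [← hall a ha]; exact mem_vadd_finset.2 ⟨b, hb, rfl⟩
  refine ⟨{ carrier := M, add_mem' := fun {a b} ha hb => hadd a ha b hb, zero_mem' := h0,
            neg_mem' := fun {a} ha => ?_ }, rfl⟩
  have : (0 : G) ∈ a +ᵥ M := by rw [hall a ha]; exact h0
  obtain ⟨b, hb, hab⟩ := mem_vadd_finset.1 this
  rw [vadd_eq_add] at hab
  rw [neg_eq_of_add_eq_zero_right hab]
  exact hb

theorem IsSidon.three_mul_card_le {M T : Finset G} (hM : IsSidon M) (hT : 3 ≤ #T) :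
    3 * #M ≤ #(M + T) + 3 := by
  obtain ⟨T', hT', hc⟩ := exists_subset_card_eq hT
  obtain ⟨a, b, c, hab, hac, hbc, rfl⟩ := card_eq_three.1 hc
  have key : ∀ x y : G, x ≠ y → #((x +ᵥ M) ∩ (y +ᵥ M)) ≤ 1 := fun x y hxy => by
    have h1 : (x +ᵥ M) ∩ (y +ᵥ M) = x +ᵥ (M ∩ ((y - x) +ᵥ M)) := by
      rw [vadd_finset_inter, vadd_vadd, add_sub_cancel]
    rw [h1, card_vadd_finset]
    exact hM _ (sub_ne_zero.2 hxy.symm)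
  have hsub : ∀ x ∈ ({a, b, c} : Finset G), x +ᵥ M ⊆ M + T := fun x hx z hz => by
    obtain ⟨y, hy, rfl⟩ := mem_vadd_finset.1 hz
    exact mem_add.2 ⟨y, hy, x, hT' hx, add_comm _ _⟩
  have h1 := card_inter_add_card_union (a +ᵥ M) (b +ᵥ M)
  have h2 := card_inter_add_card_union ((a +ᵥ M) ∪ (b +ᵥ M)) (c +ᵥ M)
  have h3 : #(((a +ᵥ M) ∪ (b +ᵥ M)) ∩ (c +ᵥ M)) ≤ 2 := by
    rw [union_inter_distrib_right]
    exact (card_union_le _ _).trans (add_le_add (key a c hac) (key b c hbc))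
  have h4 := card_le_card (union_subset (union_subset (hsub a (by simp)) (hsub b (by simp)))
    (hsub c (by simp)))
  have h5 := key a b hab
  simp only [card_vadd_finset] at h1 h2
  omega

theorem card_inter_vadd_ge {M T : Finset G} {x y : G} (hx : x ∈ T) (hy : y ∈ T) :
    2 * #M ≤ #(T + M) + #(M ∩ ((y - x) +ᵥ M)) := by
  have h1 : #(M ∩ ((y - x) +ᵥ M)) = #((x +ᵥ M) ∩ (y +ᵥ M)) := by
    rw [← card_vadd_finset x, vadd_finset_inter, vadd_vadd, add_sub_cancel]
  have h2 := card_inter_add_card_union (x +ᵥ M) (y +ᵥ M)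
  have h3 : #((x +ᵥ M) ∪ (y +ᵥ M)) ≤ #(T + M) := by
    refine card_le_card (union_subset ?_ ?_) <;> intro z hz <;>
      obtain ⟨w, hw, rfl⟩ := mem_vadd_finset.1 hz
    · exact add_mem_add hx hw
    · exact add_mem_add hy hw
  simp only [card_vadd_finset] at h2
  omega

/-- Play the atom `N` of `M` against `M`. Translates of `M` barely overlap, so `N + M` is large. If
`N` is a subgroup, counting gives both `|N| < |M|` and `|M| ≤ |N|`; if `N` is Sidon with at least
three elements, the two bounds on `|N + M|` add up to `|M| + |N| ≤ 4`. -/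
theorem IsSidon.not_isCritical [Finite G] {M X : Finset G} (hM : IsSidon M) (h0 : 0 ∈ M)
    (h3 : 3 ≤ #M) : ¬ IsCritical (AddSubgroup.closure (M : Set G)) M X := by
  intro hX
  obtain ⟨N, hN, hN0, hNs⟩ := exists_subgroup_or_sidon
    (fun x hx => AddSubgroup.subset_closure (by simpa using hx)) hX
  obtain ⟨x, hx, y, hy, hxy⟩ := one_lt_card.1 (show 1 < #N from hN.two_le)
  have hge := card_inter_vadd_ge (M := M) hx hy
  have hle := hM (y - x) (sub_ne_zero.2 hxy.symm)
  have hs := hN.small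
  have hc : #N ≤ #(N + M) := card_le_card fun z hz => by simpa using add_mem_add hz h0
  rcases hNs with ⟨H, hH⟩ | hNs
  · have hHm : ∀ z, z ∈ H ↔ z ∈ N := fun z => by rw [← SetLike.mem_coe, hH, mem_coe]
    have hsub : ¬ M ⊆ N := by
      intro hsub
      have h1 : AddSubgroup.closure (M : Set G) ≤ H := by
        rw [AddSubgroup.closure_le]
        exact fun z hz => (hHm z).2 (hsub hz)
      have h2 := Nat.card_mono (Set.toFinite (H : Set G)) h1
      have h3 : Nat.card (H : Set G) = #N := by rw [hH]; simp
      have h4 := hN.sep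
      have h5 : Nat.card (AddSubgroup.closure (M : Set G)) ≤ Nat.card (H : Set G) := h2
      omega
    obtain ⟨z, hzM, hzN⟩ := not_subset.1 hsub
    have h5 : #(N ∪ (z +ᵥ N)) ≤ #(N + M) := by
      refine card_le_card (union_subset (fun w hw => by simpa using add_mem_add hw h0) ?_)
      intro w hw
      obtain ⟨v, hv, rfl⟩ := mem_vadd_finset.1 hw
      exact mem_add.2 ⟨v, hv, z, hzM, add_comm _ _⟩
    rw [card_union_of_disjoint, card_vadd_finset] at h5
    · omega
    · rw [Finset.disjoint_left]
      intro w hw hw'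
      obtain ⟨v, hv, rfl⟩ := mem_vadd_finset.1 hw'
      refine hzN ((hHm z).1 ?_)
      have := H.sub_mem ((hHm _).2 hw) ((hHm v).2 hv)
      simpa using this
  · by_cases h2 : #N = 2
    · omega
    · have h4 := hN.two_le
      have h5 := hM.three_mul_card_le (T := N) (by omega)
      have h6 := hNs.three_mul_card_le (T := M) h3
      rw [add_comm M N] at h5
      omega

end CriticalPairs

theorem exists_toFinset_subgroup {G : Type*} [AddCommGroup G] [Finite G] (K : AddSubgroup G) :
    ∃ U : Finset G, (∀ z, z ∈ U ↔ z ∈ K) ∧ #U = Nat.card K := by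
  classical
  have := Fintype.ofFinite G
  refine ⟨univ.filter (· ∈ K), by simp, ?_⟩
  rw [Nat.card_eq_fintype_card]
  exact (Fintype.card_subtype _).symm

/-! ### Sets admitting a critical set -/

section StructureTheorem

variable {G : Type*} [AddCommGroup G] [DecidableEq G]

theorem add_mem_of_mem_closure {Y M : Finset G} (h : Y + M ⊆ Y) {g : G}
    (hg : g ∈ AddSubgroup.closure (M : Set G)) {y : G} (hy : y ∈ Y) : y + g ∈ Y := by
  have hle : AddSubgroup.closure (M : Set G) ≤ AddAction.stabilizer G Y := by
    rw [AddSubgroup.closure_le]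
    intro m hm
    refine AddAction.mem_stabilizer_iff.2 (eq_of_subset_of_card_le ?_ (card_vadd_finset _ _).ge)
    intro z hz
    obtain ⟨y, hy, rfl⟩ := mem_vadd_finset.1 hz
    exact h (mem_add.2 ⟨y, hy, m, hm, add_comm _ _⟩)
  have h1 := AddAction.mem_stabilizer_iff.1 (hle hg)
  rw [← h1]
  exact mem_vadd_finset.2 ⟨y, hy, add_comm _ _⟩

theorem IsSidon.card_add_card_le [Finite G] {M Y : Finset G} (hM : IsSidon M) (h0 : 0 ∈ M)
    (h2 : 2 ≤ #M) (hY : ∀ y ∈ Y, y ∈ AddSubgroup.closure (M : Set G)) (hYne : Y.Nonempty)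
    (hne : #(Y + M) ≠ Nat.card (AddSubgroup.closure (M : Set G))) :
    #Y + #M ≤ #(Y + M) + 1 := by
  have hML : ∀ x ∈ M, x ∈ AddSubgroup.closure (M : Set G) := fun x hx =>
    AddSubgroup.subset_closure hx
  obtain ⟨U, hU, hUc⟩ := exists_toFinset_subgroup (AddSubgroup.closure (M : Set G))
  have hsub : Y + M ⊆ U := fun z hz => by
    obtain ⟨y, hy, m, hm, rfl⟩ := mem_add.1 hz
    exact (hU _).2 (add_mem (hY y hy) (hML m hm))
  have hle := card_le_card hsub
  have hYY : Y ⊆ Y + M := fun z hz => by simpa using add_mem_add hz h0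
  have hpos := hYne.card_pos
  by_contra! hlt
  rcases h2.eq_or_lt with h2 | h3
  · have hper : Y + M ⊆ Y := (eq_of_subset_of_card_le hYY (by omega)).ge
    obtain ⟨y, hy⟩ := hYne
    refine hne (le_antisymm (hUc ▸ hle) (hUc ▸ card_le_card fun z hz => hYY ?_))
    have := add_mem_of_mem_closure hper (sub_mem ((hU z).1 hz) (hY y hy)) hy
    simpa using this
  · by_cases h1 : #Y = 1
    · obtain ⟨y, rfl⟩ := card_eq_one.1 h1
      rw [card_singleton_add] at hlt
      simp at hlt
      omega
    by_cases hsep : #(Y + M) + 2 ≤ Nat.card (AddSubgroup.closure (M : Set G))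
    · exact hM.not_isCritical h0 h3 ⟨hY, by omega, hsep, by omega⟩
    -- Here `Y + M` misses exactly one element, so the dual set is a singleton.
    · obtain ⟨Z, -, hZ1, hZ2⟩ := exists_dual hML hY
      obtain ⟨z, rfl⟩ := card_eq_one.1 (show #Z = 1 by omega)
      rw [card_singleton_add] at hZ2
      omega

/-- Cut `S` into maximal runs of step `x`. Each run adds one element to `S ∪ (x + S)`, so there is
only one run, starting at `s`. -/
theorem isArithProg_of_card_add_le [Finite G] {S : Finset G} {x : G} (hne : S.Nonempty)
    (hS : ∀ s ∈ S, s ∈ AddSubgroup.zmultiples x)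
    (hlt : #S < Nat.card (AddSubgroup.zmultiples x))
    (hle : #(({0, x} : Finset G) + S) ≤ #S + 1) : IsArithProg (S : Set G) := by
  obtain ⟨s, hs, hsx⟩ : ∃ s ∈ S, s - x ∉ S := by
    by_contra! hcon
    have hper : S + {-x} ⊆ S := fun z hz => by
      obtain ⟨y, hy, m, hm, rfl⟩ := mem_add.1 hz
      rw [mem_singleton.1 hm, ← sub_eq_add_neg]
      exact hcon y hy
    obtain ⟨U, hU, hUc⟩ := exists_toFinset_subgroup (AddSubgroup.zmultiples x)
    obtain ⟨y, hy⟩ := hne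
    refine absurd (card_le_card (s := U) (t := S) fun z hz => ?_) (by omega)
    have h1 := sub_mem ((hU z).1 hz) (hS y hy)
    have h2 : z - y ∈ AddSubgroup.closure ((({-x} : Finset G)) : Set G) := by
      rw [coe_singleton, ← AddSubgroup.zmultiples_eq_closure, AddSubgroup.zmultiples_neg]
      exact h1
    simpa using add_mem_of_mem_closure hper h2 hy
  have hstart : ∀ t ∈ S, t - x ∉ S → t = s := by
    intro t ht htx
    have hnot : ∀ t, t - x ∉ S → t ∉ x +ᵥ S := fun t htx h => by
      obtain ⟨w, hw, rfl⟩ := mem_vadd_finset.1 h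
      exact htx (by simpa using hw)
    have h1 : S ∪ (x +ᵥ S) ⊆ ({0, x} : Finset G) + S := by
      refine union_subset (fun z hz => ?_) fun z hz => ?_
      · simpa using add_mem_add (show (0 : G) ∈ ({0, x} : Finset G) by simp) hz
      · obtain ⟨w, hw, rfl⟩ := mem_vadd_finset.1 hz
        exact add_mem_add (by simp) hw
    have h2 := card_le_card h1
    have h3 := card_sdiff_add_card S (x +ᵥ S)
    rw [card_vadd_finset] at h3
    have h4 : #(S \ (x +ᵥ S)) ≤ 1 := by omega
    exact card_le_one.1 h4 t (mem_sdiff.2 ⟨ht, hnot t htx⟩) s (mem_sdiff.2 ⟨hs, hnot s hsx⟩)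
  have hback : ∀ y ∈ S, ∃ j : ℕ, y = s + j • x ∧ ∀ i ≤ j, s + i • x ∈ S := by
    intro y hy
    have hex : ∃ j : ℕ, y - j • x ∉ S := by
      have h1 : y - (s - x) ∈ AddSubgroup.zmultiples x :=
        sub_mem (hS y hy) (sub_mem (hS s hs) (AddSubgroup.mem_zmultiples x))
      rw [← mem_multiples_iff_mem_zmultiples] at h1
      obtain ⟨j, hj⟩ := h1
      refine ⟨j, ?_⟩
      have : j • x = y - (s - x) := hj
      rw [this]
      simpa using hsx
    classical
    have hfind := Nat.find_spec hex
    have hmin : ∀ i < Nat.find hex, y - i • x ∈ S := fun i hi => by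
      simpa using Nat.find_min hex hi
    obtain ⟨j, hj⟩ : ∃ j, Nat.find hex = j + 1 := by
      refine Nat.exists_eq_succ_of_ne_zero fun h => ?_
      rw [h] at hfind
      exact hfind (by simpa using hy)
    rw [hj] at hfind hmin
    have hsj : y - j • x = s := hstart _ (hmin j (by omega)) (by
      rw [sub_sub, ← succ_nsmul]; exact hfind)
    refine ⟨j, by rw [← hsj]; abel, fun i hi => ?_⟩
    have := hmin (j - i) (by omega)
    obtain ⟨e, rfl⟩ := Nat.exists_eq_add_of_le hi
    rw [← hsj, add_nsmul]
    rw [Nat.add_sub_cancel_left] at this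
    convert this using 1
    abel
  choose! j hj using hback
  obtain ⟨y, hy, hmax⟩ := exists_max_image S j hne
  refine ⟨s, x, j y, Set.ext fun z => ⟨fun hz => ⟨j z, hmax z hz, (hj z hz).1⟩, ?_⟩⟩
  rintro ⟨i, hi, rfl⟩
  exact (hj y hy).2 i hi

/-- A weak form of Hamidoune's theorem on `2`-atoms. -/
theorem isArithProg_or_exists_subgroup [Finite G] {S X : Finset G} (h0 : 0 ∈ S)
    (hX : IsCritical (AddSubgroup.closure (S : Set G)) S X) :
    IsArithProg (S : Set G) ∨ ∃ (H : AddSubgroup G) (U : Finset G), (∀ z, z ∈ U ↔ z ∈ H) ∧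
      H < AddSubgroup.closure (S : Set G) ∧ 2 ≤ #U ∧ #(S + U) + 1 ≤ #S + #U := by
  have hSK : ∀ x ∈ S, x ∈ AddSubgroup.closure (S : Set G) := fun x hx =>
    AddSubgroup.subset_closure hx
  set K := AddSubgroup.closure (S : Set G) with hK
  by_cases hS1 : #S = 1
  · left
    obtain ⟨s, rfl⟩ := card_eq_one.1 hS1
    refine ⟨s, 0, 0, Set.ext fun z => ?_⟩
    simp
  obtain ⟨M, hM, hM0, hcase⟩ := exists_subgroup_or_sidon hSK hX
  have hMS : #M ≤ #(M + S) := card_le_card fun z hz => by simpa using add_mem_add hz h0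
  have hM2 := hM.two_le
  have hMsep := hM.sep
  have hMsmall := hM.small
  rcases hcase with ⟨H, hH⟩ | hsid
  · have hHm : ∀ z, z ∈ M ↔ z ∈ H := fun z => by rw [← SetLike.mem_coe (p := H), hH, mem_coe]
    refine Or.inr ⟨H, M, hHm, lt_of_le_of_ne (fun z hz => hM.subset z ((hHm z).2 hz)) ?_,
      hM2, by rw [add_comm S M, add_comm #S]; exact hMsmall⟩
    rintro rfl
    have h1 : Nat.card ((K : AddSubgroup G) : Set G) = #M := by rw [hH]; simp
    have h2 : Nat.card ((K : AddSubgroup G) : Set G) = Nat.card K := rfl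
    omega
  set L := AddSubgroup.closure (M : Set G) with hL
  have hLK : L ≤ K := (AddSubgroup.closure_le _).2 fun z hz => hM.subset z hz
  have hML : ∀ x ∈ M, x ∈ L := fun x hx => AddSubgroup.subset_closure hx
  obtain ⟨U, hU, hUc⟩ := exists_toFinset_subgroup L
  have hMU : #M ≤ #U := card_le_card fun z hz => (hU z).2 (hML z hz)
  by_cases hLne : L = K
  · left
    rcases hM2.eq_or_lt with h2 | h3
    · obtain ⟨x, hx0, hxM⟩ : ∃ x, x ≠ 0 ∧ M = {0, x} := by
        obtain ⟨a, b, hab, rfl⟩ := card_eq_two.1 h2.symm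
        rcases (by simpa using hM0 : 0 = a ∨ 0 = b) with rfl | rfl
        · exact ⟨b, hab.symm, rfl⟩
        · exact ⟨a, hab, pair_comm _ _⟩
      have hLz : L = AddSubgroup.zmultiples x := by
        rw [hL, hxM, AddSubgroup.zmultiples_eq_closure]
        simp
      have hSS : #S ≤ #(M + S) := card_le_card fun z hz => by simpa using add_mem_add hM0 hz
      rw [← hLne, hLz] at hSK hMsep
      refine isArithProg_of_card_add_le ⟨0, h0⟩ hSK (by omega) ?_
      rw [← hxM]
      omega
    -- Criticality is nearly symmetric: `S` would be critical for the Sidon set `M`.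
    · have hpos : 0 < #S := card_pos.2 ⟨0, h0⟩
      refine absurd ⟨?_, ?_, ?_, ?_⟩ (hsid.not_isCritical (X := S) hM0 h3)
      · rw [← hL, hLne]; exact hSK
      · omega
      · rw [← hL, hLne, add_comm S]; exact hMsep
      · rw [add_comm S, add_comm #S]; exact hMsmall
  refine Or.inr ⟨L, U, hU, lt_of_le_of_ne hLK hLne, by omega, ?_⟩
  -- If `M + S` fails to fill the coset `s + L`, then `C = S ∩ (s + L)` already accounts for the
  -- growth `|M| - 1`. Hence `T = S \ C` does not grow, so it is `L`-periodic, and `S + L` lies in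
  -- `T ∪ (s + L)`.
  by_cases hfull : ∀ s ∈ S, ∀ h ∈ L, s + h ∈ M + S
  · have : #(S + U) ≤ #(M + S) := card_le_card fun z hz => by
      obtain ⟨s, hs, h, hh, rfl⟩ := mem_add.1 hz
      exact hfull s hs h ((hU h).1 hh)
    omega
  push Not at hfull
  obtain ⟨s, hs, h, hh, hsh⟩ := hfull
  classical
  set C := S.filter (fun x => x - s ∈ L) with hC
  set T := S.filter (fun x => ¬ x - s ∈ L) with hT
  have hCT : #C + #T = #S := card_filter_add_card_filter_not _
  have hsC : s ∈ C := by simp [hC, hs, L.zero_mem]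
  have hYC : #(((-s) +ᵥ C) + M) = #(C + M) := by
    rw [vadd_add_assoc, card_vadd_finset]
  have hYL : ∀ y ∈ (-s) +ᵥ C, y ∈ L := fun y hy => by
    obtain ⟨w, hw, rfl⟩ := mem_vadd_finset.1 hy
    have := (mem_filter.1 hw).2
    rwa [sub_eq_neg_add] at this
  have hYM : ((-s) +ᵥ C) + M ⊆ U := fun z hz => by
    obtain ⟨y, hy, m, hm, rfl⟩ := mem_add.1 hz
    exact (hU _).2 (add_mem (hYL y hy) (hML m hm))
  have h1 := hsid.card_add_card_le hM0 hM2 hYL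
    (vadd_finset_nonempty.2 ⟨s, hsC⟩) (fun heq => hsh (by
      have h2 := eq_of_subset_of_card_le hYM (hUc.trans heq.symm).le
      have h3 : h ∈ ((-s) +ᵥ C) + M := by rw [h2]; exact (hU h).2 hh
      obtain ⟨y, hy, m, hm, rfl⟩ := mem_add.1 h3
      obtain ⟨w, hw, rfl⟩ := mem_vadd_finset.1 hy
      refine mem_add.2 ⟨m, hm, w, (mem_filter.1 hw).1, ?_⟩
      simp only [vadd_eq_add]
      abel))
  rw [hYC, card_vadd_finset] at h1
  have hdisj : Disjoint (C + M) (T + M) := by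
    rw [Finset.disjoint_left]
    intro z hz hz'
    obtain ⟨c, hc, m, hm, rfl⟩ := mem_add.1 hz
    obtain ⟨t, ht, m', hm', heq⟩ := mem_add.1 hz'
    refine (mem_filter.1 ht).2 ?_
    have h3 : t - s = (c - s) + (m - m') := by
      rw [eq_sub_of_add_eq heq]; abel
    rw [h3]
    exact add_mem (mem_filter.1 hc).2 (sub_mem (hML m hm) (hML m' hm'))
  have h2 : #(C + M) + #(T + M) ≤ #(M + S) := by
    rw [← card_union_of_disjoint hdisj, add_comm M S]
    exact card_le_card (union_subset (add_subset_add_right (filter_subset _ _))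
      (add_subset_add_right (filter_subset _ _)))
  have hTT : T ⊆ T + M := fun z hz => by simpa using add_mem_add hz hM0
  have hper : T + M ⊆ T := (eq_of_subset_of_card_le hTT (by omega)).ge
  have h3 : S + U ⊆ T ∪ (s +ᵥ U) := fun z hz => by
    obtain ⟨w, hw, u, hu, rfl⟩ := mem_add.1 hz
    rw [hU] at hu
    by_cases hwL : w - s ∈ L
    · refine mem_union_right _ (mem_vadd_finset.2 ⟨w - s + u, (hU _).2 (add_mem hwL hu), ?_⟩)
      rw [vadd_eq_add]; abel
    · exact mem_union_left _ (add_mem_of_mem_closure hper hu (mem_filter.2 ⟨hw, hwL⟩))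
  have h4 := (card_le_card h3).trans (card_union_le _ _)
  rw [card_vadd_finset] at h4
  have h5 : 0 < #C := card_pos.2 ⟨s, hsC⟩
  omega

end StructureTheorem

/-! ### Iterated sumsets, homomorphisms and congruences -/

section Sumsets

variable {G G' : Type*} [AddCommGroup G] [AddCommGroup G']

theorem mem_hfoldSumset_zero {A : Set G} {x : G} : x ∈ hfoldSumset 0 A ↔ x = 0 := by
  simp only [hfoldSumset, Set.mem_ofPred_eq, univ_eq_empty, sum_empty]
  exact ⟨fun ⟨_, _, h⟩ => h.symm, fun h => ⟨fun i => i.elim0, fun i => i.elim0, h.symm⟩⟩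

theorem mem_hfoldSumset_succ {h : ℕ} {A : Set G} {x : G} :
    x ∈ hfoldSumset (h + 1) A ↔ ∃ a ∈ A, ∃ y ∈ hfoldSumset h A, a + y = x := by
  constructor
  · rintro ⟨f, hf, rfl⟩
    exact ⟨f 0, hf 0, _, ⟨fun i => f i.succ, fun i => hf _, rfl⟩, (Fin.sum_univ_succ f).symm⟩
  · rintro ⟨a, ha, y, ⟨f, hf, rfl⟩, rfl⟩
    refine ⟨Fin.cons a f, fun i => ?_, by simp [Fin.sum_univ_succ]⟩
    refine Fin.cases ?_ (fun j => ?_) i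
    · simpa using ha
    · simpa using hf j

theorem add_mem_hfoldSumset_succ {h : ℕ} {A : Set G} {a y : G} (ha : a ∈ A)
    (hy : y ∈ hfoldSumset h A) : a + y ∈ hfoldSumset (h + 1) A :=
  mem_hfoldSumset_succ.2 ⟨a, ha, y, hy, rfl⟩

theorem nsmul_mem_hfoldSumset {A : Set G} {a : G} (ha : a ∈ A) (h : ℕ) :
    h • a ∈ hfoldSumset h A := by
  induction h with
  | zero => simp [mem_hfoldSumset_zero]
  | succ h ih => rw [succ_nsmul']; exact add_mem_hfoldSumset_succ ha ih

theorem isSumFree_iff {k l : ℕ} {A : Set G} :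
    IsSumFree k l A ↔ ∀ x ∈ hfoldSumset k A, x ∉ hfoldSumset l A := by
  rw [IsSumFree, ← Set.disjoint_iff_inter_eq_empty, Set.disjoint_left]

theorem IsSumFree.symm {k l : ℕ} {A : Set G} (h : IsSumFree k l A) : IsSumFree l k A := by
  rwa [IsSumFree, Set.inter_comm]

theorem not_isSumFree_self {k : ℕ} {A : Set G} (hA : A.Nonempty) : ¬ IsSumFree k k A := by
  obtain ⟨a, ha⟩ := hA
  exact fun h => isSumFree_iff.1 h _ (nsmul_mem_hfoldSumset ha k) (nsmul_mem_hfoldSumset ha k)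

/-- One summand absorbs the whole kernel, so `h` must be positive. -/
theorem map_mem_hfoldSumset_iff {φ : G →+ G'} (hφ : Function.Surjective φ) {B : Set G'} {h : ℕ}
    (hh : 0 < h) {x : G} : φ x ∈ hfoldSumset h B ↔ x ∈ hfoldSumset h (φ ⁻¹' B) := by
  induction h, hh using Nat.le_induction generalizing x with
  | base =>
    simp only [Nat.succ_eq_add_one, mem_hfoldSumset_succ, mem_hfoldSumset_zero]
    simp
  | succ h hh ih =>
    simp only [mem_hfoldSumset_succ]
    constructor
    · rintro ⟨b, hb, y, hy, hxy⟩
      obtain ⟨a, rfl⟩ := hφ b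
      refine ⟨a, hb, x - a, ih.1 ?_, by abel⟩
      rw [map_sub, ← hxy, add_sub_cancel_left]
      exact hy
    · rintro ⟨a, ha, y, hy, rfl⟩
      exact ⟨φ a, ha, φ y, ih.2 hy, (map_add _ _ _).symm⟩

theorem isSumFree_preimage_iff {φ : G →+ G'} (hφ : Function.Surjective φ) {B : Set G'} {k l : ℕ}
    (hk : 0 < k) (hl : 0 < l) : IsSumFree k l (φ ⁻¹' B) ↔ IsSumFree k l B := by
  simp only [isSumFree_iff, ← map_mem_hfoldSumset_iff hφ hk, ← map_mem_hfoldSumset_iff hφ hl]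
  exact ⟨fun h y => by obtain ⟨x, rfl⟩ := hφ y; exact h x, fun h x => h _⟩

theorem ncard_preimage_mul_card [Finite G] {φ : G →+ G'} (hφ : Function.Surjective φ)
    (B : Set G') : (φ ⁻¹' B).ncard * Nat.card G' = B.ncard * Nat.card G := by
  classical
  have := Fintype.ofFinite G
  have : Finite G' := Finite.of_surjective φ hφ
  have := Fintype.ofFinite G'
  have hfib : ∀ C : Set G', (φ ⁻¹' C).ncard = C.ncard * #(univ.filter fun x => φ x = 0) := by
    intro C
    have h1 : ∀ x ∈ (φ ⁻¹' C).toFinset, φ x ∈ C.toFinset := fun x hx => by simpa using hx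
    rw [Set.ncard_eq_toFinset_card', Set.ncard_eq_toFinset_card', card_eq_sum_card_fiberwise h1]
    refine sum_const_nat fun y hy => ?_
    obtain ⟨x, rfl⟩ := hφ y
    refine card_bij' (fun z _ => z - x) (fun z _ => z + x) ?_ ?_ ?_ ?_
    · intro z hz
      simp only [mem_filter] at hz
      simp [hz.2]
    · intro z hz
      simp only [mem_filter, mem_univ, true_and] at hz
      simp only [Set.mem_toFinset] at hy
      simp [hz, hy]
    · intro z _; simp
    · intro z _; simp
  have h2 := hfib Set.univ
  rw [Set.preimage_univ, Set.ncard_univ, Set.ncard_univ] at h2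
  rw [hfib B, h2]
  ring

theorem nsmul_add_mem_hfoldSumset {A S : Set G} {a : G} (hS : ∀ s ∈ S, a + s ∈ A) {h : ℕ} {x : G}
    (hx : x ∈ hfoldSumset h S) : h • a + x ∈ hfoldSumset h A := by
  induction h generalizing x with
  | zero => simpa [mem_hfoldSumset_zero] using hx
  | succ h ih =>
    obtain ⟨s, hs, y, hy, rfl⟩ := mem_hfoldSumset_succ.1 hx
    rw [succ_nsmul', add_add_add_comm]
    exact add_mem_hfoldSumset_succ (hS s hs) (ih hy)

theorem exists_sub_mem_of_mem_hfoldSumset {A B : Set G} {H : AddSubgroup G}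
    (hB : ∀ b ∈ B, ∃ a ∈ A, b - a ∈ H) {h : ℕ} {x : G} (hx : x ∈ hfoldSumset h B) :
    ∃ y ∈ hfoldSumset h A, x - y ∈ H := by
  induction h generalizing x with
  | zero => exact ⟨0, by simp [mem_hfoldSumset_zero], by simp [mem_hfoldSumset_zero.1 hx, H.zero_mem]⟩
  | succ h ih =>
    obtain ⟨b, hb, y, hy, rfl⟩ := mem_hfoldSumset_succ.1 hx
    obtain ⟨z, hz, hyz⟩ := ih hy
    obtain ⟨a, ha, hba⟩ := hB b hb
    refine ⟨a + z, add_mem_hfoldSumset_succ ha hz, ?_⟩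
    rw [add_sub_add_comm]
    exact H.add_mem hba hyz

theorem sub_nsmul_mem_of_forall_summand {A : Set G} {H : AddSubgroup G} {y : G} {h : ℕ} {x : G}
    (hx : x ∈ hfoldSumset (h + 1) A)
    (hall : ∀ z ∈ A, ∀ w ∈ hfoldSumset h A, z + w = x → z - y ∈ H) : x - (h + 1) • y ∈ H := by
  induction h generalizing x with
  | zero =>
    obtain ⟨z, hz, w, hw, rfl⟩ := mem_hfoldSumset_succ.1 hx
    have := hall z hz w hw rfl
    rw [mem_hfoldSumset_zero.1 hw]
    simpa using this
  | succ h ih =>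
    obtain ⟨z, hz, w, hw, rfl⟩ := mem_hfoldSumset_succ.1 hx
    have h1 := ih hw fun z' hz' w' hw' h' =>
      hall z' hz' (z + w') (add_mem_hfoldSumset_succ hz hw') (by rw [← h']; abel)
    rw [succ_nsmul', add_sub_add_comm]
    exact H.add_mem (hall z hz w hw rfl) h1

theorem sub_nsmul_mem_of_mem_hfoldSumset {B : Set G} {H : AddSubgroup G} {a : G}
    (hB : ∀ b ∈ B, b - a ∈ H) {h : ℕ} {x : G} (hx : x ∈ hfoldSumset h B) : x - h • a ∈ H := by
  cases h with
  | zero => simp [mem_hfoldSumset_zero.1 hx, H.zero_mem]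
  | succ h => exact sub_nsmul_mem_of_forall_summand hx fun z hz _ _ _ => hB z hz

end Sumsets

/-! ### Sum-free progressions -/

section Progressions

variable {G G' : Type*} [AddCommGroup G] [AddCommGroup G']

theorem IsArithProg.preimage_equiv {A : Set G} (hA : IsArithProg A) (e : G' ≃+ G) :
    IsArithProg (e ⁻¹' A) := by
  obtain ⟨a, d, c, rfl⟩ := hA
  refine ⟨e.symm a, e.symm d, c, Set.ext fun x => ?_⟩
  simp only [Set.mem_preimage, Set.mem_ofPred_eq]
  refine exists_congr fun i => and_congr_right fun _ => ?_
  rw [← e.injective.eq_iff]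
  simp

theorem IsArithProg.of_vadd {A S : Set G} (hS : IsArithProg S) {a : G}
    (hA : ∀ x, x ∈ A ↔ x - a ∈ S) : IsArithProg A := by
  obtain ⟨b, d, c, rfl⟩ := hS
  refine ⟨a + b, d, c, Set.ext fun x => ?_⟩
  rw [hA]
  refine exists_congr fun i => and_congr_right fun _ => ?_
  rw [sub_eq_iff_eq_add', add_assoc]

theorem isArithProg_addSubgroup [Finite G] [IsAddCyclic G] (K : AddSubgroup G) :
    IsArithProg (K : Set G) := by
  obtain ⟨g, hg⟩ := (AddSubgroup.isAddCyclic_iff_exists_zmultiples_eq_top K).1 inferInstance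
  refine ⟨0, g, addOrderOf g, Set.ext fun x => ?_⟩
  rw [← hg, SetLike.mem_coe, ← mem_multiples_iff_mem_zmultiples]
  constructor
  · rintro ⟨i, rfl⟩
    refine ⟨i % addOrderOf g, (Nat.mod_lt _ (addOrderOf_pos g)).le, ?_⟩
    simp [mod_addOrderOf_nsmul]
  · rintro ⟨i, -, rfl⟩
    exact ⟨i, by simp⟩

theorem isSumFree_coset {A : Set G} {K : AddSubgroup G} {a : G} {k l : ℕ}
    (hA : ∀ x, x ∈ A ↔ x - a ∈ K) (hkl : k • a - l • a ∉ K) : IsSumFree k l A := by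
  refine isSumFree_iff.2 fun x hx hx' => hkl ?_
  have h1 := sub_nsmul_mem_of_mem_hfoldSumset (fun b hb => (hA b).1 hb) hx
  have h2 := sub_nsmul_mem_of_mem_hfoldSumset (fun b hb => (hA b).1 hb) hx'
  have := K.sub_mem h2 h1
  simpa using this

theorem exists_isArithProg_isSumFree_zmod {k l m n : ℕ} (hl : 0 < l) (hlk : l < k) (hm : 0 < m)
    (hn : (k + l) * m ≤ n) :
    ∃ B : Set (ZMod n), IsArithProg B ∧ IsSumFree k l B ∧ B.ncard = m := by
  obtain ⟨q, hq, rfl⟩ : ∃ q, 0 < q ∧ k = l + q := ⟨k - l, by omega, by omega⟩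
  obtain ⟨c, rfl⟩ : ∃ c, m = c + 1 := ⟨m - 1, by omega⟩
  -- The least `a` with `q * a > l * c`. All differences between a `k`-fold and an `l`-fold sum of
  -- `{a, …, a + c}` then lie strictly between `0` and `n`.
  set a := l * c / q + 1 with ha
  have ha1 : l * c < q * a := by
    have := Nat.lt_mul_div_succ (l * c) hq
    exact this
  have ha2 : q * a ≤ l * c + q := by
    rw [ha, mul_add, mul_one]
    exact Nat.add_le_add_right (Nat.mul_div_le _ _) _
  set B : Set (ZMod n) := {x | ∃ i : ℕ, i ≤ c ∧ x = (a : ZMod n) + i • (1 : ZMod n)} with hB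
  have hsum : ∀ h : ℕ, ∀ x ∈ hfoldSumset h B, ∃ i ≤ h * c, x = ((h * a + i : ℕ) : ZMod n) := by
    intro h
    induction h with
    | zero => intro x hx; exact ⟨0, by simp, by simp [mem_hfoldSumset_zero.1 hx]⟩
    | succ h ih =>
      intro x hx
      obtain ⟨b, ⟨i, hi, rfl⟩, y, hy, rfl⟩ := mem_hfoldSumset_succ.1 hx
      obtain ⟨j, hj, rfl⟩ := ih y hy
      refine ⟨i + j, by rw [Nat.succ_mul]; omega, ?_⟩
      push_cast
      rw [nsmul_one]
      ring
  refine ⟨B, ⟨a, 1, c, rfl⟩, isSumFree_iff.2 fun x hx hx' => ?_, ?_⟩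
  · obtain ⟨i, hi, hxi⟩ := hsum _ x hx
    obtain ⟨j, hj, hxj⟩ := hsum _ x hx'
    have h1 := hxi.symm.trans hxj
    rw [ZMod.natCast_eq_natCast_iff] at h1
    have h2 : (l + q) * a + i = (l * a + j) + (q * a + i - j) := by
      rw [add_mul]; omega
    have h3 := (Nat.modEq_iff_dvd' (by omega)).1 h1.symm
    have h4 : (l + q) * a + i - (l * a + j) = q * a + i - j := by omega
    rw [h4] at h3
    have h5 := Nat.le_of_dvd (by omega) h3
    have h6 : (l + q + l) * (c + 1) = (l + q) * c + l * c + (2 * l + q) := by ring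
    omega
  · have h1 : B = ((range (c + 1)).image fun i : ℕ => (a : ZMod n) + i • (1 : ZMod n) :
        Finset (ZMod n)) := by
      ext x
      simp only [hB, Set.mem_ofPred_eq, coe_image, Set.mem_image, coe_range, Set.mem_Iio]
      exact exists_congr fun i => and_congr Nat.lt_succ_iff.symm eq_comm
    rw [h1, Set.ncard_coe_finset, card_image_of_injOn, card_range]
    intro i hi j hj hij
    simp only [coe_range, Set.mem_Iio, nsmul_one] at hi hj hij
    have h2 := add_left_cancel hij
    rw [ZMod.natCast_eq_natCast_iff'] at h2
    have h3 : c + 1 ≤ n := le_trans (Nat.le_mul_of_pos_left _ (by omega)) hn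
    rwa [Nat.mod_eq_of_lt (by omega), Nat.mod_eq_of_lt (by omega)] at h2

end Progressions

/-! ### The upper bound -/

section UpperBound

variable {G : Type*} [AddCommGroup G]

/-- If `A` nearly fills the cosets of `H` it meets, but its saturation is not sum-free, then `A`
lies in one coset of `H`. -/
theorem sub_mem_of_hfoldSumset_sub_mem [DecidableEq G] {A U : Finset G} {H : AddSubgroup G}
    {k l : ℕ} (hl : 0 < l) (hk : 2 ≤ k) (hA : IsSumFree k l (A : Set G))
    (hU : ∀ z, z ∈ U ↔ z ∈ H) (hle : #(A + U) + 1 ≤ #A + #U) {u v : G}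
    (hu : u ∈ hfoldSumset k (A : Set G)) (hv : v ∈ hfoldSumset l (A : Set G)) (huv : u - v ∈ H) :
    ∃ y, ∀ z ∈ A, z - y ∈ H := by
  classical
  obtain ⟨k, rfl⟩ : ∃ k', k = k' + 2 := ⟨k - 2, by omega⟩
  obtain ⟨l, rfl⟩ : ∃ l', l = l' + 1 := ⟨l - 1, by omega⟩
  -- `A` misses at most `|H| - 1` elements of `A + H`, so any two cosets it meets share more than
  -- `|H|` elements of `A`.
  have hcard : ∀ x ∈ A, ∀ y ∈ A, x - y ∉ H →
      #U + 1 ≤ #(A.filter fun z => z - x ∈ H) + #(A.filter fun z => z - y ∈ H) := by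
    intro x hx y hy hxy
    have hd : ∀ z, z - x ∈ H → z - y ∉ H := fun z h1 h2 =>
      hxy (by simpa using H.sub_mem h2 h1)
    set T := A.filter fun z => ¬ (z - x ∈ H ∨ z - y ∈ H) with hT
    have h1 : #A = #(A.filter fun z => z - x ∈ H) + #(A.filter fun z => z - y ∈ H) + #T := by
      rw [← card_filter_add_card_filter_not (s := A) (fun z => z - x ∈ H ∨ z - y ∈ H), filter_or,
        card_union_of_disjoint]
      exact disjoint_filter.2 fun z _ => hd z
    have h2 : #(x +ᵥ U) + #(y +ᵥ U) + #T ≤ #(A + U) := by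
      rw [← card_union_of_disjoint, ← card_union_of_disjoint]
      · refine card_le_card (union_subset (union_subset ?_ ?_) ?_) <;> intro z hz
        · obtain ⟨w, hw, rfl⟩ := mem_vadd_finset.1 hz
          exact add_mem_add hx hw
        · obtain ⟨w, hw, rfl⟩ := mem_vadd_finset.1 hz
          exact add_mem_add hy hw
        · simpa using add_mem_add (mem_filter.1 hz).1 ((hU 0).2 H.zero_mem)
      · rw [Finset.disjoint_left]
        intro z hz hz'
        refine (mem_filter.1 hz').2 ?_
        rcases mem_union.1 hz with hz | hz <;> obtain ⟨w, hw, rfl⟩ := mem_vadd_finset.1 hz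
        · exact Or.inl (by simpa using (hU w).1 hw)
        · exact Or.inr (by simpa using (hU w).1 hw)
      · rw [Finset.disjoint_left]
        intro z hz hz'
        obtain ⟨w, hw, rfl⟩ := mem_vadd_finset.1 hz
        obtain ⟨w', hw', heq⟩ := mem_vadd_finset.1 hz'
        refine hd (x +ᵥ w) (by simpa using (hU w).1 hw) ?_
        rw [← heq]
        simpa using (hU w').1 hw'
    simp only [card_vadd_finset] at h2
    omega
  -- Were `x` and `y` in different cosets, shifting their parts of `A` by `u'` and `v'` would put
  -- more than `|H|` elements into one coset; a collision contradicts sum-freeness.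
  have key : ∀ x ∈ A, ∀ y ∈ A, ∀ u' ∈ hfoldSumset (k + 1) (A : Set G),
      ∀ v' ∈ hfoldSumset l (A : Set G), (x + u') - (y + v') ∈ H → x - y ∈ H := by
    intro x hx y hy u' hu' v' hv' hmem
    by_contra hxy
    have h1 := hcard x hx y hy hxy
    set C := u' +ᵥ A.filter fun z => z - x ∈ H with hC
    set D := v' +ᵥ A.filter fun z => z - y ∈ H with hD
    have h2 : C ∪ D ⊆ (x + u') +ᵥ U := by
      refine union_subset ?_ ?_ <;> intro z hz <;> obtain ⟨w, hw, rfl⟩ := mem_vadd_finset.1 hz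
      · exact mem_vadd_finset.2 ⟨w - x, (hU _).2 (mem_filter.1 hw).2, by
          simp only [vadd_eq_add]; abel⟩
      · refine mem_vadd_finset.2 ⟨(w - y) - ((x + u') - (y + v')),
          (hU _).2 (H.sub_mem (mem_filter.1 hw).2 hmem), ?_⟩
        simp only [vadd_eq_add]; abel
    have h3 := card_le_card h2
    have h4 := card_inter_add_card_union C D
    rw [card_vadd_finset] at h3
    rw [hC, hD, card_vadd_finset, card_vadd_finset, ← hC, ← hD] at h4
    obtain ⟨z, hz⟩ : (C ∩ D).Nonempty := card_pos.1 (by omega)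
    obtain ⟨hz1, hz2⟩ := mem_inter.1 hz
    obtain ⟨w, hw, rfl⟩ := mem_vadd_finset.1 hz1
    obtain ⟨w', hw', heq⟩ := mem_vadd_finset.1 hz2
    refine isSumFree_iff.1 hA (w + u')
      (add_mem_hfoldSumset_succ (mem_coe.2 (mem_filter.1 hw).1) hu') ?_
    rw [show w + u' = w' + v' by rw [add_comm w, add_comm w']; exact heq.symm]
    exact add_mem_hfoldSumset_succ (mem_coe.2 (mem_filter.1 hw').1) hv'
  obtain ⟨x, hx, u', hu', hxu⟩ := mem_hfoldSumset_succ.1 hu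
  obtain ⟨y, hy, v', hv', hyv⟩ := mem_hfoldSumset_succ.1 hv
  have huy : u - (k + 1 + 1) • y ∈ H := sub_nsmul_mem_of_forall_summand hu
    fun z hz w hw hzw => key z hz y hy w hw v' hv' (by rw [hzw, hyv]; exact huv)
  have hvy : v - (l + 1) • y ∈ H := sub_nsmul_mem_of_forall_summand hv fun z hz w hw hzw => by
    have h1 := key x hx z hz u' hu' w hw (by rw [hxu, hzw]; exact huv)
    have h2 := key x hx y hy u' hu' v' hv' (by rw [hxu, hyv]; exact huv)
    simpa using H.sub_mem h2 h1
  -- Now `u` and `v` are congruent to multiples of `y`. Adding `z` to both sides and dropping one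
  -- `y` from each keeps the congruence; this needs a second slot in the longer sum, hence `2 ≤ k`.
  refine ⟨y, fun z hz => ?_⟩
  have h1 := key y hy z hz (z + k • y)
    (add_mem_hfoldSumset_succ (mem_coe.2 hz) (nsmul_mem_hfoldSumset hy k)) (l • y)
    (nsmul_mem_hfoldSumset hy l) (by
      have h3 := H.add_mem (H.sub_mem huv huy) hvy
      have h4 : u - v - (u - (k + 1 + 1) • y) + (v - (l + 1) • y) =
        y + (z + k • y) - (z + l • y) := by
        simp only [add_nsmul, one_nsmul]; abel
      rwa [h4] at h3)
  rw [← neg_mem_iff, neg_sub]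
  exact h1

theorem mul_card_le_card_hfoldSumset [DecidableEq G] [Finite G] {S : Finset G} (h0 : 0 ∈ S)
    (h2 : 2 ≤ #S) (hno : ∀ X, ¬ IsCritical (AddSubgroup.closure (S : Set G)) S X) (j : ℕ) :
    ∃ P : Finset G, (P : Set G) = hfoldSumset (j + 1) (S : Set G) ∧ #S ≤ #P ∧
      (∀ x ∈ P, x ∈ AddSubgroup.closure (S : Set G)) ∧
      (#P + 2 ≤ Nat.card (AddSubgroup.closure (S : Set G)) → (j + 1) * #S ≤ #P) := by
  induction j with
  | zero =>
    refine ⟨S, Set.ext fun x => ?_, le_rfl, fun x hx => AddSubgroup.subset_closure hx, by simp⟩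
    simp [mem_hfoldSumset_succ, mem_hfoldSumset_zero]
  | succ j ih =>
    obtain ⟨P, hP, hSP, hPK, hPc⟩ := ih
    have hle : #P ≤ #(P + S) := card_le_card fun z hz => by simpa using add_mem_add hz h0
    refine ⟨P + S, Set.ext fun x => ?_, hSP.trans hle, ?_, fun hsep => ?_⟩
    · rw [mem_hfoldSumset_succ, ← hP, mem_coe, mem_add]
      constructor
      · rintro ⟨y, hy, s, hs, rfl⟩
        exact ⟨s, hs, y, hy, add_comm _ _⟩
      · rintro ⟨s, hs, y, hy, rfl⟩
        exact ⟨y, hy, s, hs, add_comm _ _⟩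
    · intro x hx
      obtain ⟨y, hy, s, hs, rfl⟩ := mem_add.1 hx
      exact add_mem (hPK y hy) (AddSubgroup.subset_closure hs)
    · have h1 := hPc (by omega)
      have h3 : ¬ #(P + S) + 1 ≤ #P + #S := fun h => hno P ⟨hPK, by omega, hsep, h⟩
      rw [Nat.succ_mul]
      omega

theorem add_mul_card_le_of_forall_not_isCritical [DecidableEq G] [Finite G] {A S : Finset G}
    {a : G} (hS : ∀ s ∈ S, a + s ∈ A) (h0 : 0 ∈ S) (h2 : 2 ≤ #S)
    (hno : ∀ X, ¬ IsCritical (AddSubgroup.closure (S : Set G)) S X) {k l : ℕ} (hk : 0 < k)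
    (hl : 0 < l) (hA : IsSumFree k l (A : Set G))
    (hkl : k • a - l • a ∈ AddSubgroup.closure (S : Set G)) : (k + l) * #S ≤ Nat.card G := by
  obtain ⟨k, rfl⟩ : ∃ k', k = k' + 1 := ⟨k - 1, by omega⟩
  obtain ⟨l, rfl⟩ : ∃ l', l = l' + 1 := ⟨l - 1, by omega⟩
  obtain ⟨P, hP, hSP, hPK, hPc⟩ := mul_card_le_card_hfoldSumset h0 h2 hno k
  obtain ⟨Q, hQ, hSQ, hQK, hQc⟩ := mul_card_le_card_hfoldSumset h0 h2 hno l
  have hKG := Nat.le_of_dvd Nat.card_pos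
    (AddSubgroup.card_addSubgroup_dvd_card (AddSubgroup.closure (S : Set G)))
  obtain ⟨U, hU, hUc⟩ := exists_toFinset_subgroup (AddSubgroup.closure (S : Set G))
  have hdisj : Disjoint (((k + 1) • a - (l + 1) • a) +ᵥ P) Q := by
    rw [Finset.disjoint_left]
    intro z hz hzQ
    obtain ⟨p, hp, rfl⟩ := mem_vadd_finset.1 hz
    rw [← mem_coe, hP] at hp
    rw [← mem_coe, hQ] at hzQ
    have h1 := nsmul_add_mem_hfoldSumset (A := (A : Set G)) hS hp
    have h3 := nsmul_add_mem_hfoldSumset (A := (A : Set G)) hS hzQ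
    refine isSumFree_iff.1 hA _ h1 ?_
    convert h3 using 1
    rw [vadd_eq_add]; abel
  have hsub : (((k + 1) • a - (l + 1) • a) +ᵥ P) ∪ Q ⊆ U := by
    refine union_subset (fun z hz => ?_) fun z hz => (hU z).2 (hQK z hz)
    obtain ⟨p, hp, rfl⟩ := mem_vadd_finset.1 hz
    exact (hU _).2 (add_mem hkl (hPK p hp))
  have h1 := card_le_card hsub
  rw [card_union_of_disjoint hdisj, card_vadd_finset, hUc] at h1
  -- The disjoint sets have at least `|S| ≥ 2` elements each, so each leaves two elements of the
  -- subgroup uncovered.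
  have h3 := hPc (by omega)
  have h4 := hQc (by omega)
  rw [add_mul]
  omega

theorem exists_zmod_of_isArithProg [Finite G] [IsAddCyclic G] {A : Set G} (hA : IsArithProg A)
    {k l : ℕ} (hk : 0 < k) (hl : 0 < l) (hf : IsSumFree k l A) :
    ∃ B : Set (ZMod (Nat.card G)), IsArithProg B ∧ IsSumFree k l B ∧ B.ncard = A.ncard := by
  let e : ZMod (Nat.card G) ≃+ G := zmodAddCyclicAddEquiv inferInstance
  refine ⟨e ⁻¹' A, hA.preimage_equiv e,
    (isSumFree_preimage_iff (φ := (e : ZMod (Nat.card G) →+ G)) e.surjective hk hl).2 hf, ?_⟩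
  exact Set.ncard_preimage_of_injective_subset_range e.injective (by simp [e.surjective.range_eq])

/-- Either the conclusion holds with a progression in `ZMod |G|`, or a maximum sum-free set is a
union of cosets of a nontrivial subgroup. -/
theorem exists_zmod_or_periodic [Finite G] [IsAddCyclic G] {k l : ℕ} (hl : 0 < l) (hlk : l < k)
    {A : Set G} (hA : IsSumFree k l A) (hne : A.Nonempty)
    (hmax : ∀ B : Set G, IsSumFree k l B → B.ncard ≤ A.ncard) :
    (∃ B : Set (ZMod (Nat.card G)), IsArithProg B ∧ IsSumFree k l B ∧ A.ncard ≤ B.ncard) ∨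
      ∃ H : AddSubgroup G, H ≠ ⊥ ∧ ∀ x ∈ A, ∀ h ∈ H, x + h ∈ A := by
  classical
  obtain ⟨A, rfl⟩ := (Set.toFinite A).exists_finset_coe
  by_cases hAP : IsArithProg (A : Set G)
  · left
    obtain ⟨B, hB, hBf, hBc⟩ := exists_zmod_of_isArithProg hAP (by omega) hl hA
    exact ⟨B, hB, hBf, hBc.ge⟩
  obtain ⟨a, ha⟩ := hne
  set S := (-a) +ᵥ A with hS
  have hSmem : ∀ x, x ∈ A ↔ x - a ∈ S := fun x => by
    rw [hS, sub_eq_neg_add, ← vadd_eq_add, vadd_mem_vadd_finset_iff]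
  have hSA : ∀ s ∈ S, a + s ∈ A := fun s hs => by rw [hSmem]; simpa using hs
  have hSc : #S = #A := card_vadd_finset _ _
  have h0 : 0 ∈ S := by simpa using (hSmem a).1 ha
  have hSAP : ¬ IsArithProg (S : Set G) := fun h => hAP (h.of_vadd (a := a) (by simpa using hSmem))
  have h2 : 2 ≤ #S := by
    by_contra! hlt
    have hpos : 0 < #S := card_pos.2 ⟨0, h0⟩
    obtain ⟨s, hs⟩ := card_eq_one.1 (show #S = 1 by omega)
    refine hSAP ⟨s, 0, 0, Set.ext fun z => ?_⟩
    simp [hs]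
  by_cases hcr : ∃ X, IsCritical (AddSubgroup.closure (S : Set G)) S X
  · right
    obtain ⟨X, hX⟩ := hcr
    obtain ⟨H, U, hU, hlt, hU2, hle⟩ := (isArithProg_or_exists_subgroup h0 hX).resolve_left hSAP
    refine ⟨H, ?_, ?_⟩
    · rintro rfl
      have : U ⊆ {0} := fun z hz => by simpa using (hU z).1 hz
      have := card_le_card this
      simp at this
      omega
    have hle' : #(A + U) + 1 ≤ #A + #U := by
      rw [hS, vadd_add_assoc, card_vadd_finset, card_vadd_finset] at hle
      exact hle
    have hAU : A ⊆ A + U := fun z hz => by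
      simpa using add_mem_add hz ((hU 0).2 H.zero_mem)
    by_cases hf : IsSumFree k l ((A + U : Finset G) : Set G)
    · have h1 := hmax _ hf
      rw [Set.ncard_coe_finset, Set.ncard_coe_finset] at h1
      have h3 := eq_of_subset_of_card_le hAU h1
      intro x hx h hh
      rw [mem_coe, h3]
      exact add_mem_add hx ((hU h).2 hh)
    · exfalso
      rw [isSumFree_iff] at hf
      push Not at hf
      obtain ⟨w, hwk, hwl⟩ := hf
      have hred : ∀ b ∈ ((A + U : Finset G) : Set G), ∃ a ∈ (A : Set G), b - a ∈ H := by
        intro b hb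
        obtain ⟨x, hx, h, hh, rfl⟩ := mem_add.1 (mem_coe.1 hb)
        exact ⟨x, hx, by simpa using (hU h).1 hh⟩
      obtain ⟨u, hu, hwu⟩ := exists_sub_mem_of_mem_hfoldSumset hred hwk
      obtain ⟨v, hv, hwv⟩ := exists_sub_mem_of_mem_hfoldSumset hred hwl
      obtain ⟨y, hy⟩ := sub_mem_of_hfoldSumset_sub_mem hl (by omega) hA hU hle' hu hv
        (by simpa using H.sub_mem hwv hwu)
      refine absurd ((AddSubgroup.closure_le H).2 fun s hs => ?_) (not_le_of_gt hlt)
      simpa using H.sub_mem (hy _ (hSA s hs)) (hy a ha)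
  · left
    push Not at hcr
    by_cases hkl : k • a - l • a ∈ AddSubgroup.closure (S : Set G)
    · have h1 := add_mul_card_le_of_forall_not_isCritical hSA h0 h2 hcr (by omega) hl hA hkl
      obtain ⟨B, hB, hBf, hBc⟩ := exists_isArithProg_isSumFree_zmod hl hlk (by omega) h1
      exact ⟨B, hB, hBf, by rw [hBc, Set.ncard_coe_finset, hSc]⟩
    · set C : Set G := {x | x - a ∈ AddSubgroup.closure (S : Set G)} with hC
      have hCf : IsSumFree k l C := isSumFree_coset (fun _ => Iff.rfl) hkl
      have hCAP : IsArithProg C :=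
        (isArithProg_addSubgroup (AddSubgroup.closure (S : Set G))).of_vadd fun _ => Iff.rfl
      obtain ⟨B, hB, hBf, hBc⟩ := exists_zmod_of_isArithProg hCAP (by omega) hl hCf
      refine ⟨B, hB, hBf, ?_⟩
      rw [hBc]
      exact Set.ncard_le_ncard fun x hx => AddSubgroup.subset_closure ((hSmem x).1 hx)

/-- Strong induction on the order, over all cyclic groups at once because the periodic case passes
to `G ⧸ H`. Nonemptiness guarantees that a sum-free progression exists at all. -/
theorem exists_dvd_isArithProg_of_card_eq {k l : ℕ} (hl : 0 < l) (hlk : l < k) (N : ℕ) :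
    ∀ (G : Type*) [AddCommGroup G] [Finite G] [IsAddCyclic G] (_ : Nat.card G = N) (A : Set G),
      IsSumFree k l A → A.Nonempty → ∃ d, d ∣ N ∧ ∃ B : Set (ZMod d), IsArithProg B ∧
        IsSumFree k l B ∧ A.ncard ≤ B.ncard * (N / d) := by
  induction N using Nat.strong_induction_on with
  | _ N ih =>
    intro G _ _ _ hG A₀ hA₀ hne₀
    have hk : 0 < k := by omega
    obtain ⟨⟨A, hA, hAc⟩, hub⟩ := lam_isGreatest (G := G) hk l
    have hmax : ∀ B : Set G, IsSumFree k l B → B.ncard ≤ A.ncard := fun B hB => by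
      rw [hAc]; exact hub ⟨B, hB, rfl⟩
    have hle₀ := hmax A₀ hA₀
    have hne : A.Nonempty := by
      rw [← Set.ncard_pos] at hne₀ ⊢
      omega
    have hN : 0 < N := hG ▸ Nat.card_pos
    rcases exists_zmod_or_periodic hl hlk hA hne hmax with ⟨B, hB, hBf, hBc⟩ | ⟨H, hH, hper⟩
    · subst hG
      refine ⟨_, dvd_rfl, B, hB, hBf, ?_⟩
      rw [Nat.div_self hN, mul_one]
      exact hle₀.trans hBc
    · let φ := QuotientAddGroup.mk' H
      have hφ : Function.Surjective φ := QuotientAddGroup.mk'_surjective H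
      have hpre : φ ⁻¹' (φ '' A) = A := by
        refine Set.Subset.antisymm ?_ (Set.subset_preimage_image _ _)
        rintro x ⟨y, hy, hxy⟩
        have h1 : -y + x ∈ H := QuotientAddGroup.eq.1 hxy
        simpa using hper y hy _ h1
      have hcyc : IsAddCyclic (G ⧸ H) := isAddCyclic_of_surjective φ hφ
      have hmul : Nat.card (G ⧸ H) * Nat.card H = N := by
        rw [← hG]; exact (AddSubgroup.card_eq_card_quotient_mul_card_addSubgroup H).symm
      have hlt : Nat.card (G ⧸ H) < N := by
        have h1 : 1 < Nat.card H := (AddSubgroup.one_lt_card_iff_ne_bot H).2 hH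
        have h2 : 0 < Nat.card (G ⧸ H) := Nat.card_pos
        nlinarith
      obtain ⟨d, hd, B, hB, hBf, hBc⟩ := ih _ hlt (G ⧸ H) rfl (φ '' A)
        ((isSumFree_preimage_iff hφ hk hl).1 (by rw [hpre]; exact hA)) (hne.image _)
      refine ⟨d, hd.trans ⟨_, hmul.symm⟩, B, hB, hBf, hle₀.trans ?_⟩
      have h1 := ncard_preimage_mul_card hφ (φ '' A)
      rw [hpre, hG, ← hmul] at h1
      have h2 : 0 < Nat.card (G ⧸ H) := Nat.card_pos
      have h3 : A.ncard = (φ '' A).ncard * Nat.card H := by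
        refine Nat.eq_of_mul_eq_mul_right h2 ?_
        rw [h1]; ring
      rw [h3, ← hmul, Nat.mul_div_right_comm hd, ← mul_assoc]
      exact Nat.mul_le_mul_right _ hBc

end UpperBound

end SumFreeCyclic

/-! ### The two inequalities -/

open SumFreeCyclic in
theorem theorem4 (k l n : ℕ) (hk : 0 < k) (hl : 0 < l) (hn : 0 < n) :
    SumFreeCyclic.lam k l (ZMod n) =
      n.divisors.sup (fun d => SumFreeCyclic.alpha k l (ZMod d) * (n / d)) := by
  have : NeZero n := ⟨hn.ne'⟩
  refine le_antisymm ?_ (Finset.sup_le fun d hd => ?_)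
  · obtain ⟨A, hA, hAc⟩ := (lam_isGreatest (G := ZMod n) hk l).1
    rcases A.eq_empty_or_nonempty with rfl | hne
    · rw [← hAc, Set.ncard_empty]
      exact Nat.zero_le _
    obtain ⟨d, hd, B, hB, hBf, hBc⟩ : ∃ d, d ∣ n ∧ ∃ B : Set (ZMod d), IsArithProg B ∧
        IsSumFree k l B ∧ A.ncard ≤ B.ncard * (n / d) := by
      -- The condition is symmetric in `k` and `l`, and for `k = l` only the empty set is sum-free.
      rcases lt_trichotomy l k with h | rfl | h
      · exact exists_dvd_isArithProg_of_card_eq hl h n (ZMod n) (Nat.card_zmod n) A hA hne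
      · exact absurd hA (not_isSumFree_self hne)
      · obtain ⟨d, hd, B, hB, hBf, hBc⟩ :=
          exists_dvd_isArithProg_of_card_eq hk h n (ZMod n) (Nat.card_zmod n) A hA.symm hne
        exact ⟨d, hd, B, hB, hBf.symm, hBc⟩
    have : NeZero d := ⟨(Nat.pos_of_dvd_of_pos hd hn).ne'⟩
    rw [← hAc]
    refine le_trans ?_ (Finset.le_sup (Nat.mem_divisors.2 ⟨hd, hn.ne'⟩))
    exact hBc.trans (Nat.mul_le_mul_right _
      ((alpha_isGreatest ⟨_, B, hB, hBf, rfl⟩).2 ⟨B, hB, hBf, rfl⟩))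
  · have hdn := (Nat.mem_divisors.1 hd).1
    have hd0 := Nat.pos_of_dvd_of_pos hdn hn
    have : NeZero d := ⟨hd0.ne'⟩
    rcases (sumFreeProgSizes k l (ZMod d)).eq_empty_or_nonempty with he | hne
    · rw [alpha_eq_zero he, zero_mul]
      exact Nat.zero_le _
    obtain ⟨B, -, hBf, hBc⟩ := (alpha_isGreatest hne).1
    let φ : ZMod n →+ ZMod d := (ZMod.castHom hdn (ZMod d)).toAddMonoidHom
    have hφ : Function.Surjective φ := ZMod.castHom_surjective hdn
    refine (lam_isGreatest (G := ZMod n) hk l).2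
      ⟨φ ⁻¹' B, (isSumFree_preimage_iff hφ hk hl).2 hBf, ?_⟩
    have h1 := ncard_preimage_mul_card hφ B
    rw [Nat.card_zmod, Nat.card_zmod, hBc] at h1
    refine Nat.eq_of_mul_eq_mul_right hd0 ?_
    rw [h1, mul_assoc, Nat.div_mul_cancel hdn]
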